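/- **Setting.** For $\kappa\in\mathbb C$ let $E_\kappa(z)=\exp(z+\kappa)$, and let $F(t)=e^t-1$ for $t\ge 0$. Let $\mathcal S_0$ be the set of integer sequences $\underline s=(s_1,s_2,\dots)$ that are exponentially bounded, i.e. for which there is $x>0$ with $|s_{k+1}|\le F^{\circ k}(x)$ for all $k\ge 0$; let $\sigma$ be the shift map. For $\underline s\in\mathcal S_0$ put $$t_{\underline s}=\inf\Big\{x>0:\ \limsup_{n\to\infty}\frac{|s_n|}{F^{\circ(n-1)}(x)}=0\Big\},\qquad t^*_{\underline s}=\sup_{n\ge1}F^{\circ(-n+1)}(|s_n|).$$ **Dynamic rays.** Let $L_{\kappa,j}(z)=\operatorname{Log}z-\kappa+2\pi i j$ with the principal logarithm. For $t>t^*_{\underline s}+2\log(|\kappa|+3)$ the dynamic ray of $E_\kappa$ at external address $\underline s$ is $$g^\kappa_{\underline s}(t)=\lim_{n\to\infty}L_{\kappa,s_1}\circ\cdots\circ L_{\kappa,s_n}(F^{\circ n}(t)),$$ and it is extended continuously to smaller potentials $t>t_{\underline s}$ by pulling back under the dynamics, i.e. so that $E_\kappa^{\circ m}(g^\kappa_{\underline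 s}(t))=g^\kappa_{\sigma^m\underline s}(F^{\circ m}(t))$ for all $m$. It is defined at exactly those $t>t_{\underline s}$ for which there are no $n\ge1$ and $t'\ge F^{\circ n}(t)$ with $g^\kappa_{\sigma^n\underline s}(t')=0$; in particular on all of $(t_{\underline s},\infty)$ if $E_\kappa^{\circ n}(0)\not\to\infty$. **Proposition 4.6 (The Second Derivative of Dynamic Rays).** For every $\kappa\in\mathbb C$ and $\underline s\in\mathcal S_0$, the dynamic ray $g^\kappa_{\underline s}$ is twice continuously differentiable with respect to $t$ on its whole domain of definition. Moreover, there are universal constants $A,B,C\ge0$ such that for all $\underline s\in\mathcal S_0$, all $K\ge1$, all $\kappa\in\mathbb C$ with $|\kappa|\le K$ and all real $t\ge A\,t^*_{\underline s}+B\log K+C$, the ray $g^\kappa_{\underline s}$ is defined at $t$, $(g^\kappa_{\underline s})'(t)\neq0$, and $$\big|(g^\kappa_{\underline s})''(t)\big|<e^{-t/2}\qquad\text{and}\qquad\left|\frac{(g^\kappa_{\underline s})''(t)}{(g^\kappa_{\underline s})'(t)}\right|<e^{-t/2}.$$ -/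

import Mathlib

open Filter Topology

noncomputable section

namespace ExpRays

/-- Sequences of integers `s₁ s₂ s₃ …`; the entry `s_{n+1}` is stored as `s n`. -/
abbrev Address := ℕ → ℤ

/-- The shift map `s₁ s₂ s₃ … ↦ s₂ s₃ s₄ …`. -/
def shift (s : Address) : Address := fun n => s (n + 1)

/-- The exponential map `E_κ(z) = exp(z + κ)`. -/
def E (κ z : ℂ) : ℂ := Complex.exp (z + κ)

/-- The model function for exponential growth, `F(t) = e^t - 1`; it is only used for `t ≥ 0`. -/
def F (t : ℝ) : ℝ := Real.exp t - 1

/-- The inverse of `F`. -/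
def Finv (x : ℝ) : ℝ := Real.log (1 + x)

/-- Exponentially bounded sequences: `|s_{k+1}| ≤ F^{∘k}(x)` for all `k`, for some `x > 0`. -/
def ExpBounded (s : Address) : Prop :=
  ∃ x : ℝ, 0 < x ∧ ∀ k : ℕ, |(s k : ℝ)| ≤ F^[k] x

/-- The minimal potential `t_s`: the infimum of those `x > 0` for which `|s_n| / F^{∘(n-1)}(x)`
has upper limit (equivalently, limit) `0`. -/
def minPotential (s : Address) : ℝ :=
  sInf {x : ℝ | 0 < x ∧ Tendsto (fun n : ℕ => |(s n : ℝ)| / F^[n] x) atTop (𝓝 0)}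

/-- The constant `t_s^* = sup_{n ≥ 1} F^{∘(-n+1)}(|s_n|)`. -/
def tStar (s : Address) : ℝ := ⨆ n : ℕ, Finv^[n] |(s n : ℝ)|

/-- The branch `L_{κ,j}(z) = Log z - κ + 2πij` of the inverse of `E_κ`. -/
def L (κ : ℂ) (j : ℤ) (z : ℂ) : ℂ :=
  Complex.log z - κ + 2 * Real.pi * Complex.I * j

/-- `g^n_{κ,s}(t) = L_{κ,s₁} ∘ ⋯ ∘ L_{κ,s_n} (F^{∘n}(t))`. -/
def rayApprox (κ : ℂ) : ℕ → Address → ℝ → ℂ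
  | 0, _, t => (t : ℂ)
  | n + 1, s, t => L κ (s 0) (rayApprox κ n (shift s) (F t))

/-- `γ`, on potentials `t > T`, is a piece reaching to infinity of the dynamic ray of `E_κ` at
external address `s`.

At potentials larger than `t_s^* + 2 log(|κ| + 3)`, the dynamic ray at address `s` is the limit of
the curves `g^n_{κ,s}`. It is extended to smaller potentials by continuous pull-back: `γ` is
continuous, and `E_κ^{∘m}(γ(t))` is the point of potential `F^{∘m}(t)` on the dynamic ray at address
`σ^m s` whenever `F^{∘m}(t)` lies in the above range for `σ^m s` (including `m = 0`; for every
`t > t_s` this is the case for all large `m`). As `E_κ^{∘m}` is a local homeomorphism, these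
conditions determine `γ` on `(T, ∞)`. -/
structure IsRayPiece (κ : ℂ) (s : Address) (T : ℝ) (γ : ℝ → ℂ) : Prop where
  le_left : minPotential s ≤ T
  continuousOn : ContinuousOn γ (Set.Ioi T)
  orbit : ∀ t : ℝ, T < t → ∀ m : ℕ,
    tStar (shift^[m] s) + 2 * Real.log (‖κ‖ + 3) < F^[m] t →
      Tendsto (fun n : ℕ => rayApprox κ n (shift^[m] s) (F^[m] t)) atTop
        (𝓝 ((E κ)^[m] (γ t)))

/-- `z` is the point of potential `t` on the dynamic ray of `E_κ` at external address `s`. -/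
def IsRayPoint (κ : ℂ) (s : Address) (t : ℝ) (z : ℂ) : Prop :=
  ∃ (T : ℝ) (γ : ℝ → ℂ), T < t ∧ IsRayPiece κ s T γ ∧ γ t = z

/-- The dynamic ray `t ↦ g_s^κ(t)` (with an arbitrary value where it is not defined). -/
def dynamicRay (κ : ℂ) (s : Address) (t : ℝ) : ℂ :=
  Classical.epsilon (IsRayPoint κ s t)

/-- The potentials at which `g_s^κ` is defined: all `t > t_s`, except those for which the singular
value `0` lies on the dynamic ray at some address `σ^n s`, `n ≥ 1`, at a potential `≥ F^{∘n}(t)`.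
In particular this is all of `(t_s, ∞)` if `0` is not an escaping point of `E_κ`. -/
def rayDomain (κ : ℂ) (s : Address) : Set ℝ :=
  {t : ℝ | minPotential s < t ∧
    ∀ n : ℕ, 1 ≤ n → ∀ t' : ℝ, F^[n] t ≤ t' → ¬ IsRayPoint κ (shift^[n] s) t' 0}

/-- The property `P(κ, s, t)` holds on ray tails. -/
def OnRayTails (P : ℂ → Address → ℝ → Prop) : Prop :=
  ∃ A B C : ℝ, 0 ≤ A ∧ 0 ≤ B ∧ 0 ≤ C ∧
    ∀ s : Address, ExpBounded s → ∀ K : ℝ, 1 ≤ K → ∀ κ : ℂ, ‖κ‖ ≤ K →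
      ∀ t : ℝ, A * tStar s + B * Real.log K + C ≤ t → P κ s t

end ExpRays

end

noncomputable section

namespace ExpRays

/-! ### The model map -/

/-! Far out, the ray is a uniform limit of explicit curves whose first two derivatives also converge
uniformly. Elsewhere it inherits smoothness through the local inverses of the iterates of `E κ`.

At the image potential write the approximating curve as `exp t * (1 + z)` with `z = relErr`. The
principal logarithm then yields `t + log (1 + z)`, up to the translation by `-κ + 2πi s₁`. On tails
`z` is of order `exp (-3t/4)`. The chain rule gives recursions for the speed and for its logarithmic
derivative: the former is multiplied by `(1 + z)⁻¹`, the latter becomes `D (F t) * exp t + 1 -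
speed`. Since `F t` dwarfs `t`, the factor `exp t` is harmless. Induction therefore bounds `speed -
1` and `D` (`Tail.norm_raySpeed_sub_one_le`, `Tail.norm_rayLogSpeedDeriv_le`) and makes consecutive
differences geometrically small, so that differentiation commutes with the limit. This gives the
quantitative claim.

Any potential above the minimal one enters a tail after finitely many iterations
(`exists_tail_iterate`). Near it `(E κ)^[m] ∘ γ` is the smooth tail limit composed with `F^[m]`, and
a local logarithm lifts smoothness to `γ` (`IsRayPiece.contDiffAt`). The ray is well defined: two
pieces agree on an open and closed set (`IsRayPiece.eq`), and pieces exist on the whole domain by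
lifting through `exp` step by step (`exists_isRayPiece`). -/

theorem F_strictMono : StrictMono F := fun _ _ h => by
  simpa [F] using Real.exp_lt_exp.2 h

theorem le_F (x : ℝ) : x ≤ F x := by
  have := Real.add_one_le_exp x
  unfold F; linarith

theorem F_nonneg {x : ℝ} (hx : 0 ≤ x) : 0 ≤ F x := hx.trans (le_F x)

theorem F_zero : F 0 = 0 := by simp [F]

theorem continuous_F : Continuous F := by unfold F; fun_prop

theorem hasDerivAt_F (t : ℝ) : HasDerivAt F (Real.exp t) t :=
  (Real.hasDerivAt_exp t).sub_const 1

theorem exp_eq_F_add_one (t : ℝ) : Real.exp t = F t + 1 := by unfold F; ring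

theorem F_Finv {y : ℝ} (hy : -1 < y) : F (Finv y) = y := by
  unfold F Finv
  rw [Real.exp_log (by linarith)]; ring

theorem Finv_F (x : ℝ) : Finv (F x) = x := by
  unfold F Finv
  rw [add_sub_cancel, Real.log_exp]

theorem Finv_nonneg {y : ℝ} (hy : 0 ≤ y) : 0 ≤ Finv y :=
  Real.log_nonneg (by linarith)

theorem Finv_le_Finv {y z : ℝ} (hy : 0 ≤ y) (h : y ≤ z) : Finv y ≤ Finv z :=
  Real.log_le_log (by linarith) (by linarith)

theorem iterate_F_strictMono (n : ℕ) : StrictMono F^[n] := F_strictMono.iterate n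

theorem le_iterate_F (n : ℕ) (x : ℝ) : x ≤ F^[n] x := by
  induction n generalizing x with
  | zero => rfl
  | succ n ih => exact (le_F x).trans (ih (F x))

theorem iterate_F_nonneg (n : ℕ) {x : ℝ} (hx : 0 ≤ x) : 0 ≤ F^[n] x :=
  hx.trans (le_iterate_F n x)

theorem iterate_F_zero (n : ℕ) : F^[n] 0 = 0 := Function.iterate_fixed F_zero n

theorem tendsto_iterate_F {t : ℝ} (ht : 0 < t) : Tendsto (fun n => F^[n] t) atTop atTop := by
  have key : ∀ n : ℕ, t + n * (t ^ 2 / 2) ≤ F^[n] t := by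
    intro n
    induction n with
    | zero => simp
    | succ n ih =>
      rw [Function.iterate_succ_apply']
      have h1 : t ≤ F^[n] t := le_iterate_F n t
      have h2 := Real.quadratic_le_exp_of_nonneg (ht.le.trans h1)
      have h3 : t ^ 2 ≤ (F^[n] t) ^ 2 := by gcongr
      rw [F]; push_cast; nlinarith
  refine tendsto_atTop_mono key (tendsto_atTop_add_const_left _ _ ?_)
  exact tendsto_natCast_atTop_atTop.atTop_mul_const (by positivity)

theorem F_sub_F_ge (a b : ℝ) : (b - a) * Real.exp a ≤ F b - F a := by
  have h := Real.add_one_le_exp (b - a)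
  have h2 : Real.exp b = Real.exp a * Real.exp (b - a) := by rw [← Real.exp_add]; ring_nf
  unfold F
  rw [h2]
  nlinarith [Real.exp_pos a]

theorem tendsto_iterate_F_sub {x t : ℝ} (hx : 0 ≤ x) (h : x < t) :
    Tendsto (fun n => F^[n] t - F^[n] x) atTop atTop := by
  wlog hx0 : 0 < x generalizing x
  -- The increment `x * (t - x)` used below vanishes at `x = 0`, so that case is treated separately.
  · have hx' : x = 0 := le_antisymm (not_lt.1 hx0) hx
    subst hx'
    simpa [iterate_F_zero] using tendsto_iterate_F h
  have key : ∀ n : ℕ, (t - x) + n * (x * (t - x)) ≤ F^[n] t - F^[n] x := by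
    intro n
    induction n with
    | zero => simp
    | succ n ih =>
      rw [Function.iterate_succ_apply', Function.iterate_succ_apply']
      have h1 := F_sub_F_ge (F^[n] x) (F^[n] t)
      have h2 := Real.add_one_le_exp (F^[n] x)
      have h3 := le_iterate_F n x
      have h4 : 0 ≤ n * (x * (t - x)) := by
        have : 0 < t - x := by linarith
        positivity
      have h5 : (t - x) * x ≤ (F^[n] t - F^[n] x) * F^[n] x := by
        apply mul_le_mul <;> linarith
      have h6 : (F^[n] t - F^[n] x) * (F^[n] x + 1) ≤
          (F^[n] t - F^[n] x) * Real.exp (F^[n] x) :=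
        mul_le_mul_of_nonneg_left h2 (by linarith)
      push_cast
      linarith
  refine tendsto_atTop_mono key (tendsto_atTop_add_const_left _ _ ?_)
  exact tendsto_natCast_atTop_atTop.atTop_mul_const (mul_pos hx0 (by linarith))

theorem F_div_F_le {a b : ℝ} (h : a ≤ b) (hb : 0 < b) : F a / F b ≤ Real.exp (a - b) := by
  have hF : 0 < F b := hb.trans_le (le_F b)
  rw [div_le_iff₀ hF]
  have h1 : Real.exp (a - b) * Real.exp b = Real.exp a := by rw [← Real.exp_add]; ring_nf
  have h2 : Real.exp (a - b) ≤ 1 := Real.exp_le_one_iff.2 (by linarith)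
  unfold F
  rw [mul_sub, h1]
  linarith

theorem tendsto_iterate_F_div {x t : ℝ} (hx : 0 ≤ x) (h : x < t) :
    Tendsto (fun n => F^[n] x / F^[n] t) atTop (𝓝 0) := by
  rw [← tendsto_add_atTop_iff_nat 1]
  have ht : 0 < t := hx.trans_lt h
  have h1 : Tendsto (fun n => Real.exp (F^[n] x - F^[n] t)) atTop (𝓝 0) := by
    refine Real.tendsto_exp_atBot.comp ?_
    have := tendsto_neg_atTop_atBot.comp (tendsto_iterate_F_sub hx h)
    refine this.congr fun n => ?_
    simp
  refine squeeze_zero (fun n => div_nonneg (iterate_F_nonneg _ hx) (iterate_F_nonneg _ ht.le))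
    (fun n => ?_) h1
  rw [Function.iterate_succ_apply', Function.iterate_succ_apply']
  exact F_div_F_le ((iterate_F_strictMono n).monotone h.le) (ht.trans_le (le_iterate_F n t))

/-! ### The constant `t_s^*` -/

theorem iterate_Finv_nonneg (n : ℕ) {y : ℝ} (hy : 0 ≤ y) : 0 ≤ Finv^[n] y := by
  induction n generalizing y with
  | zero => exact hy
  | succ n ih => exact ih (Finv_nonneg hy)

theorem iterate_Finv_mono (n : ℕ) {y z : ℝ} (hy : 0 ≤ y) (h : y ≤ z) :
    Finv^[n] y ≤ Finv^[n] z := by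
  induction n generalizing y z with
  | zero => exact h
  | succ n ih => exact ih (Finv_nonneg hy) (Finv_le_Finv hy h)

theorem iterate_Finv_iterate_F (n : ℕ) (x : ℝ) : Finv^[n] (F^[n] x) = x :=
  Function.LeftInverse.iterate Finv_F n x

theorem iterate_F_iterate_Finv (n : ℕ) {y : ℝ} (hy : 0 ≤ y) : F^[n] (Finv^[n] y) = y := by
  induction n generalizing y with
  | zero => rfl
  | succ n ih =>
    rw [Function.iterate_succ_apply', Function.iterate_succ_apply, ih (Finv_nonneg hy),
      F_Finv (by linarith)]

theorem ExpBounded.bddAbove {s : Address} (hs : ExpBounded s) :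
    BddAbove (Set.range fun n : ℕ => Finv^[n] |(s n : ℝ)|) := by
  obtain ⟨x, -, h⟩ := hs
  refine ⟨x, ?_⟩
  rintro _ ⟨n, rfl⟩
  exact (iterate_Finv_mono n (abs_nonneg _) (h n)).trans_eq (iterate_Finv_iterate_F n x)

theorem ExpBounded.shift {s : Address} (hs : ExpBounded s) : ExpBounded (shift s) := by
  obtain ⟨x, hx, h⟩ := hs
  exact ⟨F x, hx.trans_le (le_F x), fun k => h (k + 1)⟩

theorem ExpBounded.iterate_shift {s : Address} (hs : ExpBounded s) (n : ℕ) :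
    ExpBounded (ExpRays.shift^[n] s) := by
  induction n generalizing s with
  | zero => exact hs
  | succ n ih => exact ih hs.shift

theorem iterate_shift_apply (m : ℕ) (s : Address) (k : ℕ) : (shift^[m] s) k = s (k + m) := by
  induction m generalizing s with
  | zero => rfl
  | succ m ih =>
    rw [Function.iterate_succ_apply, ih]
    rfl

theorem tStar_nonneg (s : Address) : 0 ≤ tStar s :=
  Real.iSup_nonneg fun n => iterate_Finv_nonneg n (abs_nonneg _)

theorem abs_le_iterate_F_tStar {s : Address} (hs : ExpBounded s) (n : ℕ) :
    |(s n : ℝ)| ≤ F^[n] (tStar s) := by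
  have h : Finv^[n] |(s n : ℝ)| ≤ tStar s := le_ciSup hs.bddAbove n
  have := (iterate_F_strictMono n).monotone h
  rwa [iterate_F_iterate_Finv n (abs_nonneg _)] at this

theorem tStar_le {s : Address} {x : ℝ} (h : ∀ n, |(s n : ℝ)| ≤ F^[n] x) : tStar s ≤ x :=
  ciSup_le fun n =>
    (iterate_Finv_mono n (abs_nonneg _) (h n)).trans_eq (iterate_Finv_iterate_F n x)

theorem tStar_shift_le {s : Address} (hs : ExpBounded s) : tStar (shift s) ≤ F (tStar s) :=
  tStar_le fun n => abs_le_iterate_F_tStar hs (n + 1)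

/-! ### The minimal potential -/

theorem minPotential_nonneg (s : Address) : 0 ≤ minPotential s :=
  Real.sInf_nonneg fun _ hx => hx.1.le

theorem minPotential_le {s : Address} {x : ℝ} (hx : 0 < x)
    (h : Tendsto (fun n : ℕ => |(s n : ℝ)| / F^[n] x) atTop (𝓝 0)) : minPotential s ≤ x :=
  csInf_le ⟨0, fun _ hy => hy.1.le⟩ ⟨hx, h⟩

theorem minPotential_le_of_eventually_le {s : Address} {x : ℝ} (hx : 0 ≤ x)
    (h : ∀ᶠ n in atTop, |(s n : ℝ)| ≤ F^[n] x) : minPotential s ≤ x := by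
  refine le_of_forall_gt_imp_ge_of_dense fun y hy => ?_
  refine minPotential_le (hx.trans_lt hy) ?_
  refine squeeze_zero' (.of_forall fun n =>
    div_nonneg (abs_nonneg _) (iterate_F_nonneg n (hx.trans hy.le))) ?_
    (tendsto_iterate_F_div hx hy)
  filter_upwards [h] with n hn
  exact div_le_div_of_nonneg_right hn (iterate_F_nonneg n (hx.trans hy.le))

theorem minPotential_le_tStar {s : Address} (hs : ExpBounded s) : minPotential s ≤ tStar s :=
  minPotential_le_of_eventually_le (tStar_nonneg s) (.of_forall (abs_le_iterate_F_tStar hs))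

/-- Above the minimal potential, the address is eventually dominated by the orbit of a smaller
potential. -/
theorem exists_eventually_le_of_minPotential_lt {s : Address} (hs : ExpBounded s) {t : ℝ}
    (ht : minPotential s < t) :
    ∃ x, 0 < x ∧ x < t ∧ ∀ᶠ n in atTop, |(s n : ℝ)| ≤ F^[n] x := by
  -- Nonemptiness makes the infimum genuine rather than the default value of `sInf ∅`; `tStar s + 1`
  -- is a witness.
  have hne : {x : ℝ | 0 < x ∧
      Tendsto (fun n : ℕ => |(s n : ℝ)| / F^[n] x) atTop (𝓝 0)}.Nonempty := by
    have h0 := tStar_nonneg s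
    refine ⟨tStar s + 1, by linarith, ?_⟩
    refine squeeze_zero (fun n => div_nonneg (abs_nonneg _) (iterate_F_nonneg n (by linarith)))
      (fun n => div_le_div_of_nonneg_right (abs_le_iterate_F_tStar hs n)
        (iterate_F_nonneg n (by linarith))) (tendsto_iterate_F_div h0 (by linarith))
  obtain ⟨x, ⟨hx0, hx⟩, hxt⟩ := exists_lt_of_csInf_lt hne ht
  refine ⟨x, hx0, hxt, ?_⟩
  filter_upwards [hx.eventually_lt_const one_pos] with n hn
  rw [div_lt_one (hx0.trans_le (le_iterate_F n x))] at hn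
  exact hn.le

theorem minPotential_shift_lt {s : Address} (hs : ExpBounded s) {t : ℝ}
    (ht : minPotential s < t) : minPotential (shift s) < F t := by
  obtain ⟨x, hx0, hxt, hx⟩ := exists_eventually_le_of_minPotential_lt hs ht
  refine lt_of_le_of_lt (minPotential_le_of_eventually_le (F_nonneg hx0.le) ?_) (F_strictMono hxt)
  exact (tendsto_add_atTop_nat 1).eventually hx

/-! ### Ray tails -/

/-- The potentials at which the limit of the approximating curves is known to exist. -/
structure InRange (κ : ℂ) (s : Address) (t : ℝ) : Prop where
  expBounded : ExpBounded s
  lt : tStar s + 2 * Real.log (‖κ‖ + 3) < t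

/-- Potentials far out on the ray, where all derivatives are controlled. -/
structure Tail (κ : ℂ) (s : Address) (t : ℝ) : Prop where
  expBounded : ExpBounded s
  le : 4 * tStar s + 4 * Real.log (‖κ‖ + 3) + 100 ≤ t

variable {κ : ℂ} {s : Address} {t : ℝ}

theorem one_le_log_norm_add_three (κ : ℂ) : 1 ≤ Real.log (‖κ‖ + 3) := by
  rw [Real.le_log_iff_exp_le (by positivity)]
  have := Real.exp_one_lt_three
  have := norm_nonneg κ
  linarith

theorem exp_log_norm_add_three (κ : ℂ) : Real.exp (Real.log (‖κ‖ + 3)) = ‖κ‖ + 3 :=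
  Real.exp_log (by positivity)

theorem Tail.inRange (h : Tail κ s t) : InRange κ s t :=
  ⟨h.expBounded, by
    have := h.le
    have := one_le_log_norm_add_three κ
    have := tStar_nonneg s
    linarith⟩

theorem InRange.mono {u : ℝ} (h : InRange κ s t) (htu : t ≤ u) : InRange κ s u :=
  ⟨h.expBounded, h.lt.trans_le htu⟩

theorem Tail.mono {u : ℝ} (h : Tail κ s t) (htu : t ≤ u) : Tail κ s u :=
  ⟨h.expBounded, h.le.trans htu⟩

theorem InRange.minPotential_lt (h : InRange κ s t) : minPotential s < t := by
  have := minPotential_le_tStar h.expBounded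
  have := h.lt
  have := one_le_log_norm_add_three κ
  linarith

theorem InRange.exp_bound (h : InRange κ s t) :
    Real.exp (tStar s) * (‖κ‖ + 3) ^ 2 ≤ Real.exp t := by
  have := Real.exp_le_exp.2 h.lt.le
  rwa [Real.exp_add, mul_comm 2, Real.exp_mul, exp_log_norm_add_three, Real.rpow_two] at this

theorem InRange.shift (h : InRange κ s t) : InRange κ (shift s) (F t) := by
  refine ⟨h.expBounded.shift, ?_⟩
  have h1 := tStar_shift_le h.expBounded
  have h2 := F_sub_F_ge (tStar s) t
  have h3 := Real.add_one_le_exp (tStar s)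
  have h4 := h.lt
  have h5 := tStar_nonneg s
  have h6 := one_le_log_norm_add_three κ
  nlinarith

theorem Tail.shift (h : Tail κ s t) : Tail κ (shift s) (F t) := by
  refine ⟨h.expBounded.shift, ?_⟩
  have h1 := tStar_shift_le h.expBounded
  have h2 := Real.exp_le_exp.2 h.le
  have h5 := tStar_nonneg s
  have h6 := one_le_log_norm_add_three κ
  set a := tStar s
  set b := Real.log (‖κ‖ + 3)
  have e1 : Real.exp (4 * a + 4 * b + 100) =
    Real.exp a * (Real.exp (3 * a) * Real.exp (4 * b + 100)) := by
    rw [← Real.exp_add, ← Real.exp_add]; ring_nf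
  have h7 := Real.add_one_le_exp (4 * b + 100)
  have h8 := Real.one_le_exp (show 0 ≤ 3 * a by linarith)
  have h9 := Real.one_le_exp h5
  have h10 : 4 * b + 100 + 1 ≤ Real.exp (3 * a) * Real.exp (4 * b + 100) := by nlinarith
  rw [e1] at h2
  unfold F at h1 ⊢
  nlinarith

theorem InRange.iterate_shift (h : InRange κ s t) (n : ℕ) :
    InRange κ (ExpRays.shift^[n] s) (F^[n] t) := by
  induction n generalizing s t with
  | zero => exact h
  | succ n ih => exact ih h.shift

/-- For some `x < t` the constant `tStar` of the shifted address is at most `F^[m] x`, which is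
negligible against `F^[m] t` for large `m`. -/
theorem exists_tail_iterate (κ : ℂ) (hs : ExpBounded s) (ht : minPotential s < t) :
    ∃ m, Tail κ (shift^[m] s) (F^[m] t) := by
  obtain ⟨x, hx0, hxt, hx⟩ := exists_eventually_le_of_minPotential_lt hs ht
  obtain ⟨N, hN⟩ := eventually_atTop.1 hx
  -- With ratio `1 / 8`, the term `4 * tStar` uses at most half of `F^[m] t`; the constants use the
  -- other half.
  have h1 := (tendsto_iterate_F_div hx0.le hxt).eventually_lt_const (show (0 : ℝ) < 1 / 8 by norm_num)
  have h2 := (tendsto_iterate_F (hx0.trans hxt)).eventually_ge_atTop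
    (2 * (4 * Real.log (‖κ‖ + 3) + 100))
  obtain ⟨m, hm1, hm2, hm⟩ := (h1.and (h2.and (eventually_ge_atTop N))).exists
  refine ⟨m, hs.iterate_shift m, ?_⟩
  rw [div_lt_iff₀ ((hx0.trans hxt).trans_le (le_iterate_F m t))] at hm1
  have h3 : tStar (shift^[m] s) ≤ F^[m] x := by
    refine tStar_le fun n => ?_
    rw [iterate_shift_apply, ← Function.iterate_add_apply]
    exact hN _ (by omega)
  linarith

/-! ### The approximating curves -/

/-- The size of the deviation of the approximating curves from the real line. -/
def deviation (κ : ℂ) (s : Address) : ℝ := ‖κ‖ + 3 + 2 * Real.pi * |(s 0 : ℝ)|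

theorem three_le_deviation (κ : ℂ) (s : Address) : 3 ≤ deviation κ s := by
  have : 0 ≤ 2 * Real.pi * |(s 0 : ℝ)| := by positivity
  have := norm_nonneg κ
  unfold deviation; linarith

/-- The relative error of the `n`-th approximation at the image of `(s, t)`. -/
def relErr (κ : ℂ) (n : ℕ) (s : Address) (t : ℝ) : ℂ :=
  rayApprox κ n (shift s) (F t) / Real.exp t - 1

theorem rayApprox_shift_eq (κ : ℂ) (n : ℕ) (s : Address) (t : ℝ) :
    rayApprox κ n (shift s) (F t) = (Real.exp t : ℝ) * (1 + relErr κ n s t) := by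
  have : ((Real.exp t : ℝ) : ℂ) ≠ 0 := by exact_mod_cast (Real.exp_pos t).ne'
  rw [relErr]; field_simp; ring

theorem one_add_ne_zero_of_norm_lt {z : ℂ} (hz : ‖z‖ < 1) : 1 + z ≠ 0 := fun h => by
  have : z = -1 := by linear_combination h
  simp [this] at hz

theorem rayApprox_succ_eq {n : ℕ} (h : ‖relErr κ n s t‖ < 1) :
    rayApprox κ (n + 1) s t =
      t + Complex.log (1 + relErr κ n s t) - κ + 2 * Real.pi * Complex.I * (s 0) := by
  rw [rayApprox, L, rayApprox_shift_eq,
    Complex.log_ofReal_mul (Real.exp_pos t) (one_add_ne_zero_of_norm_lt h), Real.log_exp]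

theorem norm_relErr_le {n : ℕ}
    (h : ‖rayApprox κ n (shift s) (F t) - F t‖ ≤ deviation κ (shift s) - 1) :
    ‖relErr κ n s t‖ ≤ deviation κ (shift s) * Real.exp (-t) := by
  have hne : ((Real.exp t : ℝ) : ℂ) ≠ 0 := by exact_mod_cast (Real.exp_pos t).ne'
  have e : relErr κ n s t = (rayApprox κ n (shift s) (F t) - F t - 1) / (Real.exp t : ℝ) := by
    rw [relErr, div_sub_one hne, exp_eq_F_add_one]; push_cast; ring
  rw [e, norm_div, Complex.norm_real, Real.norm_of_nonneg (Real.exp_pos t).le, Real.exp_neg,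
    ← div_eq_mul_inv]
  refine div_le_div_of_nonneg_right ?_ (Real.exp_pos t).le
  refine (norm_sub_le _ _).trans ?_
  rw [norm_one]; linarith

theorem deviation_shift_le (h : ExpBounded s) :
    deviation κ (shift s) ≤ ‖κ‖ + 3 + 2 * Real.pi * (Real.exp (tStar s) - 1) := by
  have : |(s 1 : ℝ)| ≤ Real.exp (tStar s) - 1 := abs_le_iterate_F_tStar h 1
  unfold deviation shift
  gcongr

/-- The bound `7 / 10` works because `c = ‖κ‖ + 3 ≥ 3` gives `7 / 10 * c ^ 2 ≥ 6.3`, which exceeds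
`2π` by `π < 3.15`. -/
theorem InRange.deviation_mul_exp_le (h : InRange κ s t) :
    deviation κ (ExpRays.shift s) * Real.exp (-t) ≤ 7 / 10 := by
  have h1 := deviation_shift_le (κ := κ) h.expBounded
  have h2 := h.exp_bound
  have h3 := Real.one_le_exp (tStar_nonneg s)
  have h4 : 3 ≤ ‖κ‖ + 3 := by simp
  have h5 := Real.pi_lt_d2
  rw [Real.exp_neg, ← div_eq_mul_inv, div_le_iff₀ (Real.exp_pos t)]
  set x := Real.exp (tStar s)
  set c := ‖κ‖ + 3
  nlinarith [mul_nonneg (show 0 ≤ 7 / 10 * c ^ 2 - 2 * Real.pi by nlinarith)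
    (show 0 ≤ x - 1 by linarith)]

/-- For `‖z‖ ≤ 7 / 10` the logarithm of `1 + z` contributes at most 2, whence `‖κ‖ + 2 + 2π|s₁|`.
The unit by which this falls short of `deviation` pays for `exp t = F t + 1` when passing to
`relErr`. -/
theorem InRange.norm_rayApprox_sub_le (h : InRange κ s t) (n : ℕ) :
    ‖rayApprox κ n s t - t‖ ≤ deviation κ s - 1 := by
  induction n generalizing s t with
  | zero =>
    have := three_le_deviation κ s
    simp only [rayApprox, sub_self, norm_zero]; linarith
  | succ n ih =>
    have hz : ‖relErr κ n s t‖ ≤ 7 / 10 :=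
      (norm_relErr_le (ih h.shift)).trans h.deviation_mul_exp_le
    have hz1 : ‖relErr κ n s t‖ < 1 := by linarith
    have hl := Complex.norm_log_one_add_le hz1
    have hl2 : ‖Complex.log (1 + relErr κ n s t)‖ ≤ 2 := by
      refine hl.trans ?_
      have : (1 - ‖relErr κ n s t‖)⁻¹ ≤ 10 / 3 := by
        rw [inv_le_comm₀ (by linarith) (by norm_num)]; linarith
      have h2 : ‖relErr κ n s t‖ ^ 2 ≤ (7 / 10) ^ 2 := by gcongr
      have h3 : ‖relErr κ n s t‖ ^ 2 * (1 - ‖relErr κ n s t‖)⁻¹ ≤ (7 / 10) ^ 2 * (10 / 3) := by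
        gcongr
      linarith
    rw [rayApprox_succ_eq hz1]
    have e : (t : ℂ) + Complex.log (1 + relErr κ n s t) - κ + 2 * Real.pi * Complex.I * (s 0) - t
      = Complex.log (1 + relErr κ n s t) - κ + 2 * Real.pi * Complex.I * (s 0) := by ring
    rw [e]
    have h1 : ‖2 * Real.pi * Complex.I * (s 0 : ℂ)‖ = 2 * Real.pi * |(s 0 : ℝ)| := by
      simp [abs_of_pos Real.pi_pos]
    have h2 := norm_add_le (Complex.log (1 + relErr κ n s t) - κ) (2 * Real.pi * Complex.I * (s 0))
    have h3 := norm_sub_le (Complex.log (1 + relErr κ n s t)) κ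
    unfold deviation; linarith

theorem InRange.norm_relErr_le (h : InRange κ s t) (n : ℕ) : ‖relErr κ n s t‖ ≤ 7 / 10 :=
  (ExpRays.norm_relErr_le (h.shift.norm_rayApprox_sub_le n)).trans h.deviation_mul_exp_le

/-- A bound uniform in `n` keeps the arguments of all the logarithms, and their limits, off the
branch cut. -/
theorem InRange.re_rayApprox_ge (h : InRange κ s t) (n : ℕ) :
    3 / 10 ≤ (rayApprox κ n (ExpRays.shift s) (F t)).re := by
  have h1 := h.norm_relErr_le n
  have h2 := (abs_le.1 ((Complex.abs_re_le_norm (relErr κ n s t)).trans h1)).1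
  rw [rayApprox_shift_eq, Complex.re_ofReal_mul, Complex.add_re, Complex.one_re]
  have h3 : 1 ≤ Real.exp t := by
    have h4 := h.exp_bound
    have h5 := Real.one_le_exp (tStar_nonneg s)
    have h6 := norm_nonneg κ
    nlinarith
  nlinarith

theorem InRange.rayApprox_mem_slitPlane (h : InRange κ s t) (n : ℕ) :
    rayApprox κ n (ExpRays.shift s) (F t) ∈ Complex.slitPlane :=
  Or.inl (by linarith [h.re_rayApprox_ge n])

/-! ### Estimates on ray tails -/

theorem Tail.hundred_le (h : Tail κ s t) : 100 ≤ t := by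
  have := h.le
  have := one_le_log_norm_add_three κ
  have := tStar_nonneg s
  linarith

theorem Tail.deviation_le (h : Tail κ s t) :
    deviation κ (ExpRays.shift s) ≤ Real.exp (t / 4) / 16 := by
  have h1 := deviation_shift_le (κ := κ) h.expBounded
  have h2 : Real.exp (tStar s + Real.log (‖κ‖ + 3) + 25) ≤ Real.exp (t / 4) :=
    Real.exp_le_exp.2 (by linarith [h.le])
  rw [Real.exp_add, Real.exp_add, exp_log_norm_add_three] at h2
  have h3 := Real.one_le_exp (tStar_nonneg s)
  have h4 : 3 ≤ ‖κ‖ + 3 := by simp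
  have h5 := Real.pi_lt_d2
  have h6 : (160 : ℝ) ≤ Real.exp 25 :=
    le_trans (by norm_num) (Real.quadratic_le_exp_of_nonneg (x := 25) (by norm_num))
  set x := Real.exp (tStar s)
  set c := ‖κ‖ + 3
  have h7 : x * c * 160 ≤ x * c * Real.exp 25 := by gcongr
  have h8 : c + 2 * Real.pi * (x - 1) ≤ x * c * 10 := by nlinarith
  linarith

theorem Tail.norm_relErr_le (h : Tail κ s t) (n : ℕ) :
    ‖relErr κ n s t‖ ≤ Real.exp (-(3 / 4) * t) / 16 := by
  refine (ExpRays.norm_relErr_le (h.inRange.shift.norm_rayApprox_sub_le n)).trans ?_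
  have h1 := mul_le_mul_of_nonneg_right h.deviation_le (Real.exp_pos (-t)).le
  refine h1.trans_eq ?_
  rw [div_mul_eq_mul_div, ← Real.exp_add]
  ring_nf

theorem Tail.exp_le_fourth (h : Tail κ s t) : Real.exp (-(1 / 4) * t) ≤ 1 / 16 := by
  have h1 := h.hundred_le
  have h2 : Real.exp (-(1 / 4) * t) = (Real.exp (t / 4))⁻¹ := by
    rw [← Real.exp_neg]; ring_nf
  rw [h2, inv_le_comm₀ (Real.exp_pos _) (by norm_num)]
  linarith [Real.add_one_le_exp (t / 4)]

/-- `F` grows quickly on ray tails. -/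
theorem Tail.mul_le_F (h : Tail κ s t) : 10 * t ≤ F t := by
  have h1 := h.hundred_le
  have h2 := Real.quadratic_le_exp_of_nonneg (show 0 ≤ t by linarith)
  unfold F; nlinarith

theorem norm_log_sub_log_le {z w : ℂ} (hz : ‖z‖ ≤ 1 / 2) (hw : ‖w‖ ≤ 1 / 2) :
    ‖Complex.log (1 + z) - Complex.log (1 + w)‖ ≤ 2 * ‖z - w‖ := by
  have hd : ∀ x ∈ Metric.closedBall (0 : ℂ) (1 / 2),
      HasDerivWithinAt (fun x : ℂ => Complex.log (1 + x)) (1 / (1 + x))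
        (Metric.closedBall (0 : ℂ) (1 / 2)) x := by
    intro x hx
    have hx' : ‖x‖ ≤ 1 / 2 := by simpa using hx
    refine (HasDerivAt.clog ((hasDerivAt_id x).const_add 1) ?_).hasDerivWithinAt
    refine Or.inl ?_
    have := (abs_le.1 ((Complex.abs_re_le_norm x).trans hx')).1
    simp; linarith
  have hb : ∀ x ∈ Metric.closedBall (0 : ℂ) (1 / 2), ‖1 / (1 + x)‖ ≤ 2 := by
    intro x hx
    have hx' : ‖x‖ ≤ 1 / 2 := by simpa using hx
    have h1 : 1 - ‖x‖ ≤ ‖1 + x‖ := by simpa using norm_sub_norm_le (1 : ℂ) (-x)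
    rw [norm_div, norm_one, div_le_iff₀ (by linarith)]; linarith
  exact (convex_closedBall (0 : ℂ) (1 / 2)).norm_image_sub_le_of_norm_hasDerivWithin_le hd hb
    (by simpa using hw) (by simpa using hz)

theorem Tail.exp_small (h : Tail κ s t) : Real.exp (-(3 / 4) * t) ≤ 1 / 16 :=
  (Real.exp_le_exp.2 (by linarith [h.hundred_le])).trans h.exp_le_fourth

theorem Tail.norm_relErr_le_half (h : Tail κ s t) (n : ℕ) : ‖relErr κ n s t‖ ≤ 1 / 2 := by
  have := h.norm_relErr_le n
  have := h.exp_small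
  linarith

theorem relErr_sub_relErr (κ : ℂ) (n m : ℕ) (s : Address) (t : ℝ) :
    relErr κ n s t - relErr κ m s t =
      (rayApprox κ n (shift s) (F t) - rayApprox κ m (shift s) (F t)) * (Real.exp (-t) : ℝ) := by
  rw [relErr, relErr, Real.exp_neg]; push_cast; ring

theorem norm_relErr_sub_relErr (κ : ℂ) (n m : ℕ) (s : Address) (t : ℝ) :
    ‖relErr κ n s t - relErr κ m s t‖ =
      ‖rayApprox κ n (shift s) (F t) - rayApprox κ m (shift s) (F t)‖ * Real.exp (-t) := by
  rw [relErr_sub_relErr, norm_mul, Complex.norm_real, Real.norm_of_nonneg (Real.exp_pos _).le]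

/-- One pull-back multiplies differences by at most `2 * exp (-t)`. As `2 * (7 / 10) ≤ 3 / 2 ≤
deviation κ s / 2`, each step gains the factor `1 / 2`. -/
theorem Tail.norm_rayApprox_succ_sub_le (h : Tail κ s t) (n : ℕ) :
    ‖rayApprox κ (n + 1) s t - rayApprox κ n s t‖ ≤ deviation κ s / 2 ^ n := by
  induction n generalizing s t with
  | zero =>
    have := h.inRange.norm_rayApprox_sub_le 1
    simp only [rayApprox, pow_zero, div_one] at this ⊢
    linarith
  | succ n ih =>
    have h1 := h.norm_relErr_le_half n
    have h2 := h.norm_relErr_le_half (n + 1)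
    rw [rayApprox_succ_eq (h1.trans_lt (by norm_num)),
      rayApprox_succ_eq (h2.trans_lt (by norm_num))]
    have e : ∀ a b c d k : ℂ, a + b - k + c - (a + d - k + c) = b - d := fun _ _ _ _ _ => by ring
    rw [e]
    refine (norm_log_sub_log_le h2 h1).trans ?_
    rw [norm_relErr_sub_relErr]
    have h3 : deviation κ (ExpRays.shift s) * Real.exp (-t) ≤ 7 / 10 :=
      h.inRange.deviation_mul_exp_le
    have h4 := mul_le_mul_of_nonneg_right (ih h.shift) (Real.exp_pos (-t)).le
    have h5 := three_le_deviation κ s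
    have h6 : 0 < (2 : ℝ) ^ n := by positivity
    have h7 : deviation κ (ExpRays.shift s) / 2 ^ n * Real.exp (-t) ≤ 7 / 10 / 2 ^ n := by
      rw [div_mul_eq_mul_div]; gcongr
    have h8 : (3 : ℝ) / 2 ^ (n + 1) ≤ deviation κ s / 2 ^ (n + 1) := by gcongr
    have h9 : 2 * ((7 : ℝ) / 10 / 2 ^ n) ≤ 3 / 2 ^ (n + 1) := by
      rw [pow_succ]; field_simp; norm_num
    linarith

/-! ### Derivatives of the approximating curves -/

/-- The derivative of `rayApprox κ n s`. -/
def raySpeed (κ : ℂ) : ℕ → Address → ℝ → ℂ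
  | 0, _, _ => 1
  | n + 1, s, t => raySpeed κ n (shift s) (F t) * (1 + relErr κ n s t)⁻¹

/-- The logarithmic derivative of `raySpeed κ n s`. -/
def rayLogSpeedDeriv (κ : ℂ) : ℕ → Address → ℝ → ℂ
  | 0, _, _ => 0
  | n + 1, s, t =>
    rayLogSpeedDeriv κ n (shift s) (F t) * (Real.exp t : ℝ) + 1 - raySpeed κ (n + 1) s t

theorem InRange.one_add_relErr_ne_zero (h : InRange κ s t) (n : ℕ) : 1 + relErr κ n s t ≠ 0 :=
  one_add_ne_zero_of_norm_lt ((h.norm_relErr_le n).trans_lt (by norm_num))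

theorem InRange.hasDerivAt_rayApprox (h : InRange κ s t) (n : ℕ) :
    HasDerivAt (rayApprox κ n s) (raySpeed κ n s t) t := by
  induction n generalizing s t with
  | zero => simpa [rayApprox, raySpeed] using (hasDerivAt_id t).ofReal_comp
  | succ n ih =>
    have h1 : HasDerivAt (fun u => rayApprox κ n (ExpRays.shift s) (F u))
        (Real.exp t • raySpeed κ n (ExpRays.shift s) (F t)) t :=
      (ih h.shift).scomp t (hasDerivAt_F t)
    have h2 := ((h1.clog_real (h.rayApprox_mem_slitPlane n)).sub_const κ).add_const
      (2 * Real.pi * Complex.I * (s 0 : ℂ))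
    refine h2.congr_deriv ?_
    have hne : ((Real.exp t : ℝ) : ℂ) ≠ 0 := by exact_mod_cast (Real.exp_pos t).ne'
    have := h.one_add_relErr_ne_zero n
    rw [rayApprox_shift_eq, raySpeed, Complex.real_smul]
    field_simp

theorem InRange.hasDerivAt_relErr (h : InRange κ s t) (n : ℕ) :
    HasDerivAt (relErr κ n s)
      (raySpeed κ n (ExpRays.shift s) (F t) - (1 + relErr κ n s t)) t := by
  have h1 : HasDerivAt (fun u => rayApprox κ n (ExpRays.shift s) (F u))
      (Real.exp t • raySpeed κ n (ExpRays.shift s) (F t)) t :=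
    (h.shift.hasDerivAt_rayApprox n).scomp t (hasDerivAt_F t)
  have hne : ((Real.exp t : ℝ) : ℂ) ≠ 0 := by exact_mod_cast (Real.exp_pos t).ne'
  have h2 := (h1.div (Real.hasDerivAt_exp t).ofReal_comp hne).sub_const 1
  refine h2.congr_deriv ?_
  rw [rayApprox_shift_eq, Complex.real_smul]
  field_simp

/-- Logarithmic differentiation of `speed (F t) * (1 + z)⁻¹`: since `z' = speed (F t) - (1 + z)`,
the second factor contributes `-z' / (1 + z) = 1 - speed`. -/
theorem InRange.hasDerivAt_raySpeed (h : InRange κ s t) (n : ℕ) :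
    HasDerivAt (raySpeed κ n s) (raySpeed κ n s t * rayLogSpeedDeriv κ n s t) t := by
  induction n generalizing s t with
  | zero => simpa [raySpeed, rayLogSpeedDeriv] using hasDerivAt_const t (1 : ℂ)
  | succ n ih =>
    have h1 : HasDerivAt (fun u => raySpeed κ n (ExpRays.shift s) (F u)) (Real.exp t •
        (raySpeed κ n (ExpRays.shift s) (F t) * rayLogSpeedDeriv κ n (ExpRays.shift s) (F t))) t :=
      (ih h.shift).scomp t (hasDerivAt_F t)
    have hne := h.one_add_relErr_ne_zero n
    have h2 := h1.mul (((h.hasDerivAt_relErr n).const_add 1).inv hne)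
    refine h2.congr_deriv ?_
    rw [rayLogSpeedDeriv, raySpeed, Complex.real_smul, Pi.inv_apply]
    field_simp
    ring

theorem InRange.continuousAt_rayLogSpeedDeriv (h : InRange κ s t) (n : ℕ) :
    ContinuousAt (rayLogSpeedDeriv κ n s) t := by
  induction n generalizing s t with
  | zero => exact continuousAt_const
  | succ n ih =>
    have h1 : ContinuousAt (fun u => rayLogSpeedDeriv κ n (ExpRays.shift s) (F u)) t :=
      (ih h.shift).comp continuous_F.continuousAt
    have h2 : ContinuousAt (fun u : ℝ => ((Real.exp u : ℝ) : ℂ)) t := by fun_prop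
    exact ((h1.mul h2).add continuousAt_const).sub (h.hasDerivAt_raySpeed (n + 1)).continuousAt

/-- Every spare `t / 4` in an exponent buys a factor `1 / 16`, which absorbs the constants arising
in the inductions below. -/
theorem Tail.exp_le_exp_div (h : Tail κ s t) {x y : ℝ} (hxy : x ≤ y - t / 4) :
    Real.exp x ≤ Real.exp y / 16 := by
  have h1 := Real.exp_le_exp.2 hxy
  have h2 : Real.exp (y - t / 4) = Real.exp y * Real.exp (-(1 / 4) * t) := by
    rw [← Real.exp_add]; ring_nf
  rw [h2] at h1
  have h3 := mul_le_mul_of_nonneg_left h.exp_le_fourth (Real.exp_pos y).le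
  linarith

theorem norm_inv_one_add_le {z : ℂ} (hz : ‖z‖ ≤ 1 / 2) : ‖(1 + z)⁻¹‖ ≤ 2 := by
  have h1 : 1 - ‖z‖ ≤ ‖1 + z‖ := by simpa using norm_sub_norm_le (1 : ℂ) (-z)
  rw [norm_inv, inv_le_comm₀ (by linarith) (by norm_num)]; linarith

theorem norm_inv_one_add_sub_le {z w : ℂ} (hz : ‖z‖ ≤ 1 / 2) (hw : ‖w‖ ≤ 1 / 2) :
    ‖(1 + z)⁻¹ - (1 + w)⁻¹‖ ≤ 4 * ‖z - w‖ := by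
  have h1 := one_add_ne_zero_of_norm_lt (hz.trans_lt (by norm_num))
  have h2 := one_add_ne_zero_of_norm_lt (hw.trans_lt (by norm_num))
  have e : (1 + z)⁻¹ - (1 + w)⁻¹ = -((1 + z)⁻¹ * (1 + w)⁻¹ * (z - w)) := by
    field_simp; ring
  rw [e, norm_neg, norm_mul, norm_mul]
  have := mul_le_mul (norm_inv_one_add_le hz) (norm_inv_one_add_le hw) (norm_nonneg _)
    (by norm_num)
  exact mul_le_mul_of_nonneg_right (by linarith) (norm_nonneg _)

theorem Tail.norm_raySpeed_sub_one_le (h : Tail κ s t) (n : ℕ) :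
    ‖raySpeed κ n s t - 1‖ ≤ Real.exp (-(3 / 4) * t) := by
  induction n generalizing s t with
  | zero => simpa [raySpeed] using (Real.exp_pos _).le
  | succ n ih =>
    have hz := h.norm_relErr_le n
    have hz2 := h.norm_relErr_le_half n
    have h1 := ih h.shift
    have h2 : Real.exp (-(3 / 4) * F t) ≤ Real.exp (-(3 / 4) * t) / 16 :=
      h.exp_le_exp_div (by linarith [h.mul_le_F, h.hundred_le])
    have h3 := norm_inv_one_add_le hz2
    have h4 : ‖(1 + relErr κ n s t)⁻¹ - 1‖ ≤ 4 * ‖relErr κ n s t‖ := by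
      simpa using norm_inv_one_add_sub_le hz2 (w := 0) (by norm_num)
    have e : raySpeed κ (n + 1) s t - 1 = (raySpeed κ n (ExpRays.shift s) (F t) - 1) *
        (1 + relErr κ n s t)⁻¹ + ((1 + relErr κ n s t)⁻¹ - 1) := by
      rw [raySpeed]; ring
    rw [e]
    refine (norm_add_le _ _).trans ?_
    rw [norm_mul]
    have h5 := mul_le_mul (h1.trans h2) h3 (norm_nonneg _) (by positivity)
    have := Real.exp_pos (-(3 / 4) * t)
    linarith

theorem Tail.norm_raySpeed_le (h : Tail κ s t) (n : ℕ) : ‖raySpeed κ n s t‖ ≤ 17 / 16 := by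
  have h1 := h.norm_raySpeed_sub_one_le n
  have h2 := h.exp_small
  have h3 := norm_add_le (raySpeed κ n s t - 1) 1
  rw [sub_add_cancel, norm_one] at h3
  linarith

/-- The inductive bound at `F t` beats the factor `exp t` because `F t ≥ 10 * t`; what remains is
`speed - 1`, of smaller order `exp (-3t/4)`. -/
theorem Tail.norm_rayLogSpeedDeriv_le (h : Tail κ s t) (n : ℕ) :
    ‖rayLogSpeedDeriv κ n s t‖ ≤ Real.exp (-t / 2) / 2 := by
  induction n generalizing s t with
  | zero => simp only [rayLogSpeedDeriv, norm_zero]; positivity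
  | succ n ih =>
    have ht := h.hundred_le
    have h1 := mul_le_mul_of_nonneg_right (ih h.shift) (Real.exp_pos t).le
    have h2 : Real.exp (-F t / 2) * Real.exp t ≤ Real.exp (-t / 2) / 16 := by
      rw [← Real.exp_add]
      exact h.exp_le_exp_div (by linarith [h.mul_le_F])
    have h3 := h.norm_raySpeed_sub_one_le (n + 1)
    have h4 : Real.exp (-(3 / 4) * t) ≤ Real.exp (-t / 2) / 16 := h.exp_le_exp_div (by linarith)
    have e : rayLogSpeedDeriv κ (n + 1) s t =
      rayLogSpeedDeriv κ n (ExpRays.shift s) (F t) * (Real.exp t : ℝ) -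
        (raySpeed κ (n + 1) s t - 1) := by
      rw [rayLogSpeedDeriv]; ring
    rw [e]
    refine (norm_sub_le _ _).trans ?_
    rw [norm_mul, Complex.norm_real, Real.norm_of_nonneg (Real.exp_pos t).le]
    have := Real.exp_pos (-t / 2)
    linarith

theorem Tail.norm_raySpeed_succ_sub_le (h : Tail κ s t) (n : ℕ) :
    ‖raySpeed κ (n + 1) s t - raySpeed κ n s t‖ ≤ Real.exp (-t / 2) / 2 ^ n := by
  have ht := h.hundred_le
  have h0 : Real.exp (-(3 / 4) * t) ≤ Real.exp (-t / 2) / 16 := h.exp_le_exp_div (by linarith)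
  have hpos := Real.exp_pos (-t / 2)
  induction n generalizing s t with
  | zero =>
    have := h.norm_raySpeed_sub_one_le 1
    simp only [raySpeed, pow_zero, div_one] at this ⊢
    linarith
  | succ n ih =>
    have h1 := ih h.shift h.shift.hundred_le
      (h.shift.exp_le_exp_div (by linarith [h.shift.hundred_le])) (Real.exp_pos _)
    have h2 : Real.exp (-F t / 2) ≤ Real.exp (-t / 2) / 16 :=
      h.exp_le_exp_div (by linarith [h.mul_le_F])
    have h3 := norm_inv_one_add_le (h.norm_relErr_le_half (n + 1))
    have h4 := norm_inv_one_add_sub_le (h.norm_relErr_le_half (n + 1)) (h.norm_relErr_le_half n)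
    rw [norm_relErr_sub_relErr] at h4
    have h5 := mul_le_mul_of_nonneg_right (h.shift.norm_rayApprox_succ_sub_le n)
      (Real.exp_pos (-t)).le
    have h6 : deviation κ (ExpRays.shift s) * Real.exp (-t) ≤ Real.exp (-(3 / 4) * t) / 16 := by
      refine (mul_le_mul_of_nonneg_right h.deviation_le (Real.exp_pos (-t)).le).trans_eq ?_
      rw [div_mul_eq_mul_div, ← Real.exp_add]
      ring_nf
    have hn : (0 : ℝ) < 2 ^ n := by positivity
    have h7 : ‖(1 + relErr κ (n + 1) s t)⁻¹ - (1 + relErr κ n s t)⁻¹‖ ≤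
        Real.exp (-t / 2) / 64 / 2 ^ n := by
      have h8 : deviation κ (ExpRays.shift s) / 2 ^ n * Real.exp (-t) ≤
          Real.exp (-t / 2) / 256 / 2 ^ n := by
        rw [div_mul_eq_mul_div]
        gcongr
        linarith
      have h9 : 4 * (Real.exp (-t / 2) / 256 / 2 ^ n) = Real.exp (-t / 2) / 64 / 2 ^ n := by ring
      linarith
    have h10 := h.shift.norm_raySpeed_le n
    have e : raySpeed κ (n + 1 + 1) s t - raySpeed κ (n + 1) s t =
        (raySpeed κ (n + 1) (ExpRays.shift s) (F t) - raySpeed κ n (ExpRays.shift s) (F t)) *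
          (1 + relErr κ (n + 1) s t)⁻¹ + raySpeed κ n (ExpRays.shift s) (F t) *
          ((1 + relErr κ (n + 1) s t)⁻¹ - (1 + relErr κ n s t)⁻¹) := by
      rw [show raySpeed κ (n + 1 + 1) s t = raySpeed κ (n + 1) (ExpRays.shift s) (F t) *
        (1 + relErr κ (n + 1) s t)⁻¹ from rfl, show raySpeed κ (n + 1) s t =
        raySpeed κ n (ExpRays.shift s) (F t) * (1 + relErr κ n s t)⁻¹ from rfl]
      ring
    rw [e]
    refine (norm_add_le _ _).trans ?_
    rw [norm_mul, norm_mul]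
    have h11 : Real.exp (-F t / 2) / 2 ^ n ≤ Real.exp (-t / 2) / 16 / 2 ^ n := by gcongr
    have h12 := mul_le_mul (h1.trans h11) h3 (norm_nonneg _) (by positivity)
    have h13 := mul_le_mul h10 h7 (norm_nonneg _) (by norm_num)
    have h14 : Real.exp (-t / 2) / 2 ^ (n + 1) = Real.exp (-t / 2) / 2 ^ n / 2 := by
      rw [pow_succ, div_div]
    have h15 : 0 < Real.exp (-t / 2) / 2 ^ n := by positivity
    have h16 : ∀ c : ℝ, Real.exp (-t / 2) / c / 2 ^ n = Real.exp (-t / 2) / 2 ^ n / c :=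
      fun c => div_right_comm _ _ _
    rw [h16] at h12 h13
    rw [h14]
    linarith

/-- The weight is weaker than the `exp (-t / 2)` for speeds, so that the speed difference entering
the recursion costs only a sixteenth of it. -/
theorem Tail.norm_rayLogSpeedDeriv_succ_sub_le (h : Tail κ s t) (n : ℕ) :
    ‖rayLogSpeedDeriv κ (n + 1) s t - rayLogSpeedDeriv κ n s t‖ ≤ Real.exp (-t / 4) / 2 ^ n := by
  have hpos := Real.exp_pos (-t / 4)
  induction n generalizing s t with
  | zero =>
    have h1 := h.norm_rayLogSpeedDeriv_le 1
    have h2 : Real.exp (-t / 2) ≤ Real.exp (-t / 4) / 16 := h.exp_le_exp_div (by linarith)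
    rw [rayLogSpeedDeriv.eq_def κ 0]
    simp only [pow_zero, div_one, sub_zero] at h1 ⊢
    linarith
  | succ n ih =>
    have h1 := mul_le_mul_of_nonneg_right (ih h.shift (Real.exp_pos _)) (Real.exp_pos t).le
    have h2 : Real.exp (-F t / 4) * Real.exp t ≤ Real.exp (-t / 4) / 16 := by
      rw [← Real.exp_add]
      exact h.exp_le_exp_div (by linarith [h.mul_le_F, h.hundred_le])
    have h3 := h.norm_raySpeed_succ_sub_le (n + 1)
    have h4 : Real.exp (-t / 2) ≤ Real.exp (-t / 4) / 16 := h.exp_le_exp_div (by linarith)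
    have e : rayLogSpeedDeriv κ (n + 1 + 1) s t - rayLogSpeedDeriv κ (n + 1) s t =
        (rayLogSpeedDeriv κ (n + 1) (ExpRays.shift s) (F t) -
          rayLogSpeedDeriv κ n (ExpRays.shift s) (F t)) * (Real.exp t : ℝ) -
        (raySpeed κ (n + 1 + 1) s t - raySpeed κ (n + 1) s t) := by
      rw [show rayLogSpeedDeriv κ (n + 1 + 1) s t =
        rayLogSpeedDeriv κ (n + 1) (ExpRays.shift s) (F t) * (Real.exp t : ℝ) + 1 -
          raySpeed κ (n + 1 + 1) s t from rfl, show rayLogSpeedDeriv κ (n + 1) s t =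
        rayLogSpeedDeriv κ n (ExpRays.shift s) (F t) * (Real.exp t : ℝ) + 1 -
          raySpeed κ (n + 1) s t from rfl]
      ring
    rw [e]
    refine (norm_sub_le _ _).trans ?_
    rw [norm_mul, Complex.norm_real, Real.norm_of_nonneg (Real.exp_pos t).le]
    have hn : (0 : ℝ) < 2 ^ n := by positivity
    have h5 : Real.exp (-F t / 4) / 2 ^ n * Real.exp t ≤ Real.exp (-t / 4) / 16 / 2 ^ n := by
      rw [div_mul_eq_mul_div]; gcongr
    have h6 : Real.exp (-t / 2) / 2 ^ (n + 1) ≤ Real.exp (-t / 4) / 16 / 2 ^ n := by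
      gcongr
      · norm_num
      · omega
    have h14 : Real.exp (-t / 4) / 2 ^ (n + 1) = Real.exp (-t / 4) / 2 ^ n / 2 := by
      rw [pow_succ, div_div]
    have h15 : 0 < Real.exp (-t / 4) / 2 ^ n := by positivity
    rw [div_right_comm] at h5 h6
    rw [h14]
    linarith

/-! ### The limit on ray tails -/

theorem tendstoUniformlyOn_limUnder_of_geometric {f : ℕ → ℝ → ℂ} {S : Set ℝ} (C : ℝ)
    (h : ∀ n, ∀ t ∈ S, ‖f (n + 1) t - f n t‖ ≤ C / 2 ^ n) :
    TendstoUniformlyOn f (fun t => limUnder atTop fun n => f n t) atTop S := by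
  have hd : ∀ t ∈ S, ∀ n, dist (f n t) (f (n + 1) t) ≤ 2 * C / 2 / 2 ^ n := fun t ht n => by
    rw [dist_comm, dist_eq_norm, mul_div_cancel_left₀ C two_ne_zero]
    exact h n t ht
  have hl : ∀ t ∈ S, ∀ n, dist (f n t) (limUnder atTop fun n => f n t) ≤ 2 * C / 2 ^ n :=
    fun t ht n => dist_le_of_le_geometric_two_of_tendsto (hd t ht)
      (cauchySeq_of_le_geometric_two (hd t ht)).tendsto_limUnder n
  have h0 : Tendsto (fun n : ℕ => 2 * C / 2 ^ n) atTop (𝓝 0) :=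
    tendsto_const_nhds.div_atTop (tendsto_pow_atTop_atTop_of_one_lt one_lt_two)
  rw [Metric.tendstoUniformlyOn_iff]
  intro ε hε
  filter_upwards [h0.eventually_lt_const hε] with n hn t ht
  rw [dist_comm]
  exact (hl t ht n).trans_lt hn

/-- The limit of the approximating curves. -/
def rayLimit (κ : ℂ) (s : Address) (t : ℝ) : ℂ := limUnder atTop fun n => rayApprox κ n s t

/-- The derivative of `rayLimit`. -/
def rayLimitSpeed (κ : ℂ) (s : Address) (t : ℝ) : ℂ := limUnder atTop fun n => raySpeed κ n s t

/-- The second derivative of `rayLimit`. -/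
def rayLimitAccel (κ : ℂ) (s : Address) (t : ℝ) : ℂ :=
  limUnder atTop fun n => raySpeed κ n s t * rayLogSpeedDeriv κ n s t

theorem tendstoUniformlyOn_rayApprox (κ : ℂ) (s : Address) :
    TendstoUniformlyOn (fun n => rayApprox κ n s) (rayLimit κ s) atTop {t | Tail κ s t} :=
  tendstoUniformlyOn_limUnder_of_geometric (deviation κ s)
    fun n _ ht => Tail.norm_rayApprox_succ_sub_le ht n

theorem tendstoUniformlyOn_raySpeed (κ : ℂ) (s : Address) :
    TendstoUniformlyOn (fun n => raySpeed κ n s) (rayLimitSpeed κ s) atTop {t | Tail κ s t} :=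
  tendstoUniformlyOn_limUnder_of_geometric 1 fun n t (ht : Tail κ s t) =>
    (ht.norm_raySpeed_succ_sub_le n).trans (div_le_div_of_nonneg_right
      (Real.exp_le_one_iff.2 (by linarith [ht.hundred_le])) (by positivity))

theorem tendstoUniformlyOn_rayAccel (κ : ℂ) (s : Address) :
    TendstoUniformlyOn (fun n t => raySpeed κ n s t * rayLogSpeedDeriv κ n s t)
      (rayLimitAccel κ s) atTop {t | Tail κ s t} := by
  refine tendstoUniformlyOn_limUnder_of_geometric 3 fun n t (ht : Tail κ s t) => ?_
  have h1 := ht.norm_raySpeed_succ_sub_le n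
  have h2 := ht.norm_rayLogSpeedDeriv_succ_sub_le n
  have h3 := ht.norm_raySpeed_le (n + 1)
  have h4 := ht.norm_rayLogSpeedDeriv_le n
  have h5 : Real.exp (-t / 2) ≤ 1 := Real.exp_le_one_iff.2 (by linarith [ht.hundred_le])
  have h6 : Real.exp (-t / 4) ≤ 1 := Real.exp_le_one_iff.2 (by linarith [ht.hundred_le])
  have h7 : Real.exp (-t / 2) / 2 ^ n ≤ 1 / 2 ^ n := by gcongr
  have h8 : Real.exp (-t / 4) / 2 ^ n ≤ 1 / 2 ^ n := by gcongr
  have e : raySpeed κ (n + 1) s t * rayLogSpeedDeriv κ (n + 1) s t -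
      raySpeed κ n s t * rayLogSpeedDeriv κ n s t =
      raySpeed κ (n + 1) s t * (rayLogSpeedDeriv κ (n + 1) s t - rayLogSpeedDeriv κ n s t) +
      (raySpeed κ (n + 1) s t - raySpeed κ n s t) * rayLogSpeedDeriv κ n s t := by ring
  rw [e]
  refine (norm_add_le _ _).trans ?_
  rw [norm_mul, norm_mul]
  have h9 := mul_le_mul h3 (h2.trans h8) (norm_nonneg _) (by norm_num)
  have h10 := mul_le_mul (h1.trans h7) (h4.trans (show _ ≤ (1 : ℝ) by linarith)) (norm_nonneg _)
    (by positivity)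
  have h11 : (3 : ℝ) / 2 ^ n = 3 * (1 / 2 ^ n) := by ring
  have h12 : (0 : ℝ) < 1 / 2 ^ n := by positivity
  rw [h11]
  linarith

theorem Tail.tendsto_rayApprox (h : Tail κ s t) :
    Tendsto (fun n => rayApprox κ n s t) atTop (𝓝 (rayLimit κ s t)) :=
  (tendstoUniformlyOn_rayApprox κ s).tendsto_at h

theorem Tail.hasDerivAt_rayLimit {t₀ : ℝ} (h : Tail κ s t₀) (ht : t₀ < t) :
    HasDerivAt (rayLimit κ s) (rayLimitSpeed κ s t) t := by
  have hsub : Set.Ioi t₀ ⊆ {t | Tail κ s t} := fun u hu => h.mono (le_of_lt hu)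
  exact hasDerivAt_of_tendstoUniformlyOn isOpen_Ioi ((tendstoUniformlyOn_raySpeed κ s).mono hsub)
    (.of_forall fun n u hu => (hsub hu).inRange.hasDerivAt_rayApprox n)
    (fun u hu => (hsub hu).tendsto_rayApprox) ht

theorem Tail.hasDerivAt_rayLimitSpeed {t₀ : ℝ} (h : Tail κ s t₀) (ht : t₀ < t) :
    HasDerivAt (rayLimitSpeed κ s) (rayLimitAccel κ s t) t := by
  have hsub : Set.Ioi t₀ ⊆ {t | Tail κ s t} := fun u hu => h.mono (le_of_lt hu)
  exact hasDerivAt_of_tendstoUniformlyOn isOpen_Ioi ((tendstoUniformlyOn_rayAccel κ s).mono hsub)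
    (.of_forall fun n u hu => (hsub hu).inRange.hasDerivAt_raySpeed n)
    (fun u hu => (tendstoUniformlyOn_raySpeed κ s).tendsto_at (hsub hu)) ht

theorem Tail.contDiffOn_rayLimit {t₀ : ℝ} (h : Tail κ s t₀) :
    ContDiffOn ℝ 2 (rayLimit κ s) (Set.Ioi t₀) := by
  have hsub : Set.Ioi t₀ ⊆ {t | Tail κ s t} := fun u hu => h.mono (le_of_lt hu)
  have hc : ContinuousOn (rayLimitAccel κ s) (Set.Ioi t₀) :=
    ((tendstoUniformlyOn_rayAccel κ s).mono hsub).continuousOn <| Frequently.of_forall fun n u hu =>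
      ((hsub hu).inRange.hasDerivAt_raySpeed n).continuousAt.continuousWithinAt.mul
        ((hsub hu).inRange.continuousAt_rayLogSpeedDeriv n).continuousWithinAt
  have h1 : ContDiffOn ℝ 1 (rayLimitSpeed κ s) (Set.Ioi t₀) := by
    rw [show (1 : WithTop ℕ∞) = 0 + 1 from rfl, contDiffOn_succ_iff_deriv_of_isOpen isOpen_Ioi]
    refine ⟨fun u hu => (h.hasDerivAt_rayLimitSpeed hu).differentiableAt.differentiableWithinAt,
      by simp, ?_⟩
    rw [contDiffOn_zero]
    exact hc.congr fun u hu => (h.hasDerivAt_rayLimitSpeed hu).deriv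
  rw [show (2 : WithTop ℕ∞) = 1 + 1 from one_add_one_eq_two.symm,
    contDiffOn_succ_iff_deriv_of_isOpen isOpen_Ioi]
  exact ⟨fun u hu => (h.hasDerivAt_rayLimit hu).differentiableAt.differentiableWithinAt,
    by simp, h1.congr fun u hu => (h.hasDerivAt_rayLimit hu).deriv⟩

theorem Tail.norm_rayLimitSpeed_sub_one_le (h : Tail κ s t) : ‖rayLimitSpeed κ s t - 1‖ ≤ 1 / 16 :=
  le_of_tendsto (((tendstoUniformlyOn_raySpeed κ s).tendsto_at h).sub_const 1).norm
    (.of_forall fun n => (h.norm_raySpeed_sub_one_le n).trans h.exp_small)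

theorem Tail.norm_rayLimitAccel_le (h : Tail κ s t) :
    ‖rayLimitAccel κ s t‖ ≤ 17 / 32 * Real.exp (-t / 2) := by
  refine le_of_tendsto ((tendstoUniformlyOn_rayAccel κ s).tendsto_at h).norm
    (.of_forall fun n => ?_)
  rw [norm_mul]
  have := mul_le_mul (h.norm_raySpeed_le n) (h.norm_rayLogSpeedDeriv_le n) (norm_nonneg _)
    (by norm_num)
  linarith

/-! ### Convergence of the approximating curves -/

/-- Convergence is known on tails and is carried back through one logarithm at a time, by induction
on the number of iterations needed to reach a tail. -/
theorem InRange.exists_tendsto_rayApprox (h : InRange κ s t) :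
    ∃ z, Tendsto (fun n => rayApprox κ n s t) atTop (𝓝 z) := by
  obtain ⟨m, hm⟩ := exists_tail_iterate κ h.expBounded h.minPotential_lt
  induction m generalizing s t with
  | zero => exact ⟨_, hm.tendsto_rayApprox⟩
  | succ m ih =>
    obtain ⟨z, hz⟩ := ih h.shift hm
    have hre : 3 / 10 ≤ z.re :=
      ge_of_tendsto (Complex.continuous_re.continuousAt.tendsto.comp hz)
        (.of_forall fun n => h.re_rayApprox_ge n)
    refine ⟨L κ (s 0) z, ?_⟩
    rw [← tendsto_add_atTop_iff_nat 1]
    exact ((hz.clog (Or.inl (by linarith))).sub_const κ).add_const _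

theorem InRange.tendsto_rayApprox (h : InRange κ s t) :
    Tendsto (fun n => rayApprox κ n s t) atTop (𝓝 (rayLimit κ s t)) :=
  tendsto_nhds_limUnder h.exists_tendsto_rayApprox

theorem InRange.re_rayLimit_pos (h : InRange κ s t) :
    0 < (rayLimit κ (ExpRays.shift s) (F t)).re :=
  lt_of_lt_of_le (by norm_num) <|
    ge_of_tendsto (Complex.continuous_re.continuousAt.tendsto.comp h.shift.tendsto_rayApprox)
      (.of_forall fun n => h.re_rayApprox_ge n)

theorem InRange.rayLimit_eq (h : InRange κ s t) :
    rayLimit κ s t = L κ (s 0) (rayLimit κ (ExpRays.shift s) (F t)) := by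
  refine tendsto_nhds_unique (h.tendsto_rayApprox.comp (tendsto_add_atTop_nat 1)) ?_
  exact ((h.shift.tendsto_rayApprox.clog (Or.inl h.re_rayLimit_pos)).sub_const κ).add_const _

theorem E_L (κ : ℂ) (j : ℤ) {z : ℂ} (hz : z ≠ 0) : E κ (L κ j z) = z := by
  have e : L κ j z + κ = Complex.log z + j * (2 * Real.pi * Complex.I) := by rw [L]; ring
  rw [E, e, Complex.exp_add, Complex.exp_int_mul_two_pi_mul_I, mul_one, Complex.exp_log hz]

theorem InRange.E_rayLimit (h : InRange κ s t) :
    E κ (rayLimit κ s t) = rayLimit κ (ExpRays.shift s) (F t) := by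
  rw [h.rayLimit_eq, E_L]
  intro h0
  have := h.re_rayLimit_pos
  simp [h0] at this

theorem InRange.iterate_E_rayLimit (h : InRange κ s t) (m : ℕ) :
    (E κ)^[m] (rayLimit κ s t) = rayLimit κ (ExpRays.shift^[m] s) (F^[m] t) := by
  induction m generalizing s t with
  | zero => rfl
  | succ m ih => rw [Function.iterate_succ_apply, h.E_rayLimit, ih h.shift]; rfl

/-! ### Lifting through the exponential map -/

/-- The difference of two lifts lies in `2πiℤ` and is continuous, so it vanishes as long as its
imaginary part stays below `π` in modulus. -/
theorem eventuallyEq_of_E_comp {f g : ℝ → ℂ} (hf : ContinuousAt f t) (hg : ContinuousAt g t)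
    (h0 : f t = g t) (h : ∀ᶠ u in 𝓝 t, E κ (f u) = E κ (g u)) : f =ᶠ[𝓝 t] g := by
  have hc : ContinuousAt (fun u => |(f u - g u).im|) t :=
    (Complex.continuous_im.continuousAt.comp (hf.sub hg)).abs
  have hlt : ∀ᶠ u in 𝓝 t, |(f u - g u).im| < Real.pi :=
    hc.eventually_lt_const (by simpa [h0] using Real.pi_pos)
  filter_upwards [h, hlt] with u hu hlu
  have h1 : Complex.exp (f u - g u) = 1 := by
    have e : f u - g u = (f u + κ) - (g u + κ) := by ring
    rw [e, Complex.exp_sub, show Complex.exp (f u + κ) = Complex.exp (g u + κ) from hu,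
      div_self (Complex.exp_ne_zero _)]
  have h2 := Complex.log_exp (abs_lt.1 hlu).1 (abs_lt.1 hlu).2.le
  rw [h1, Complex.log_one] at h2
  exact sub_eq_zero.1 h2.symm

theorem continuous_E (κ : ℂ) : Continuous (E κ) := by unfold E; fun_prop

theorem eventuallyEq_of_iterate_E_comp {m : ℕ} {f g : ℝ → ℂ} (hf : ContinuousAt f t)
    (hg : ContinuousAt g t) (h0 : f t = g t)
    (h : ∀ᶠ u in 𝓝 t, (E κ)^[m] (f u) = (E κ)^[m] (g u)) : f =ᶠ[𝓝 t] g := by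
  induction m generalizing f g with
  | zero => exact h
  | succ m ih =>
    exact eventuallyEq_of_E_comp hf hg h0 <|
      ih (f := fun u => E κ (f u)) (g := fun u => E κ (g u))
        ((continuous_E κ).continuousAt.comp hf) ((continuous_E κ).continuousAt.comp hg)
        (congrArg (E κ) h0) h

/-- Near `t` the lift is recovered as `f t + log (E (f u) / E (f t))`, with the quotient close to 1,
where the principal logarithm is smooth. -/
theorem contDiffAt_of_E_comp {n : WithTop ℕ∞} {f : ℝ → ℂ} (hf : ContinuousAt f t)
    (h : ContDiffAt ℝ n (fun u => E κ (f u)) t) : ContDiffAt ℝ n f t := by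
  have hc : ContinuousAt (fun u => |(f u - f t).im|) t :=
    (Complex.continuous_im.continuousAt.comp (hf.sub continuousAt_const)).abs
  have hlt : ∀ᶠ u in 𝓝 t, |(f u - f t).im| < Real.pi :=
    hc.eventually_lt_const (by simpa using Real.pi_pos)
  have hne : E κ (f t) ≠ 0 := Complex.exp_ne_zero _
  have hlog : ContDiffAt ℝ n Complex.log (E κ (f t) / E κ (f t)) :=
    (Complex.contDiffAt_log (by rw [div_self hne]; exact Complex.one_mem_slitPlane)).restrict_scalars ℝ
  have h1 : ContDiffAt ℝ n (fun u => f t + Complex.log (E κ (f u) / E κ (f t))) t :=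
    contDiffAt_const.add
      (ContDiffAt.comp (g := Complex.log) t hlog (h.div_const _))
  refine h1.congr_of_eventuallyEq ?_
  filter_upwards [hlt] with u hu
  have e : E κ (f u) / E κ (f t) = Complex.exp (f u - f t) := by
    rw [E, E, ← Complex.exp_sub]; ring_nf
  rw [e, Complex.log_exp (abs_lt.1 hu).1 (abs_lt.1 hu).2.le]
  ring

theorem contDiffAt_of_iterate_E_comp {n : WithTop ℕ∞} {m : ℕ} {f : ℝ → ℂ}
    (hf : ContinuousAt f t) (h : ContDiffAt ℝ n (fun u => (E κ)^[m] (f u)) t) :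
    ContDiffAt ℝ n f t := by
  induction m generalizing f with
  | zero => exact h
  | succ m ih =>
    exact contDiffAt_of_E_comp hf
      (ih (f := fun u => E κ (f u)) ((continuous_E κ).continuousAt.comp hf) h)

/-- The set of local agreement is open, and relatively closed by continuity together with `h`; a
half-line is connected. -/
theorem eqOn_Ioi_of_locally_eq {R t₀ : ℝ} {f g : ℝ → ℂ} (hf : ContinuousOn f (Set.Ioi R))
    (hg : ContinuousOn g (Set.Ioi R)) (ht₀ : R < t₀) (h0 : f t₀ = g t₀)
    (h : ∀ t, R < t → f t = g t → f =ᶠ[𝓝 t] g) : Set.EqOn f g (Set.Ioi R) := by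
  have key : Set.Ioi R ⊆ {t | f =ᶠ[𝓝 t] g} := by
    refine isPreconnected_Ioi.subset_of_closure_inter_subset ?_ ⟨t₀, ht₀, h t₀ ht₀ h0⟩ ?_
    · exact isOpen_iff_mem_nhds.2 fun t ht => eventually_eventually_nhds.2 ht
    · rintro t ⟨htc, htR⟩
      refine h t htR ?_
      have hfr : ∃ᶠ u in 𝓝 t, f u = g u :=
        (mem_closure_iff_frequently.1 htc).mono fun u hu => hu.self_of_nhds
      have hft := hf.continuousAt (Ioi_mem_nhds htR)
      have hgt := hg.continuousAt (Ioi_mem_nhds htR)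
      by_contra hne
      exact hfr ((hft.ne_iff_eventually_ne hgt).1 hne)
  exact fun t ht => (key ht).self_of_nhds

theorem exists_continuousOn_exp_eq {T : ℝ} {f : ℝ → ℂ} (hf : ContinuousOn f (Set.Ioi T))
    (h0 : ∀ u, T < u → f u ≠ 0) :
    ∃ g : ℝ → ℂ, ContinuousOn g (Set.Ioi T) ∧ ∀ u, T < u → Complex.exp (g u) = f u := by
  have hsc : IsSimplyConnected (Set.Ioi T) := by
    have := (convex_Ioi T).contractibleSpace Set.nonempty_Ioi
    exact SimplyConnectedSpace.ofContractible _
  obtain ⟨g, hg, hge⟩ := Complex.exists_continuousOn_eqOn_exp_comp hsc isOpen_Ioi hf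
    (by rintro ⟨u, hu, hu0⟩; exact h0 u hu hu0)
  exact ⟨g, hg, fun u hu => hge hu⟩

/-! ### Ray pieces -/

theorem IsRayPiece.iterate_E_eq {T : ℝ} {γ : ℝ → ℂ} (h : IsRayPiece κ s T γ) (ht : T < t)
    {m : ℕ} (hm : InRange κ (shift^[m] s) (F^[m] t)) :
    (E κ)^[m] (γ t) = rayLimit κ (shift^[m] s) (F^[m] t) :=
  tendsto_nhds_unique (h.orbit t ht m hm.lt) hm.tendsto_rayApprox

theorem exists_tail_lt {T : ℝ} (κ : ℂ) (hs : ExpBounded s) (hT : minPotential s ≤ T) (ht : T < t) :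
    ∃ t₁ m, T < t₁ ∧ t₁ < t ∧ Tail κ (shift^[m] s) (F^[m] t₁) := by
  obtain ⟨t₁, h1, h2⟩ := exists_between ht
  obtain ⟨m, hm⟩ := exists_tail_iterate κ hs (hT.trans_lt h1)
  exact ⟨t₁, m, h1, h2, hm⟩

theorem contDiff_iterate_F {n : WithTop ℕ∞} (m : ℕ) : ContDiff ℝ n F^[m] := by
  induction m with
  | zero => exact contDiff_id
  | succ m ih =>
    rw [Function.iterate_succ]
    refine ih.comp ?_
    unfold F
    fun_prop

theorem IsRayPiece.contDiffAt {T : ℝ} {γ : ℝ → ℂ} (h : IsRayPiece κ s T γ) (hs : ExpBounded s)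
    (ht : T < t) : ContDiffAt ℝ 2 γ t := by
  obtain ⟨t₁, m, h1, h2, hm⟩ := exists_tail_lt κ hs h.le_left ht
  refine contDiffAt_of_iterate_E_comp (κ := κ) (m := m)
    (h.continuousOn.continuousAt (Ioi_mem_nhds ht)) ?_
  have hF : ContDiff ℝ 2 F^[m] := contDiff_iterate_F m
  have hlim := (hm.contDiffOn_rayLimit).contDiffAt
    (Ioi_mem_nhds ((iterate_F_strictMono m) h2))
  refine (ContDiffAt.comp t hlim hF.contDiffAt).congr_of_eventuallyEq ?_
  filter_upwards [Ioi_mem_nhds h2] with u hu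
  exact h.iterate_E_eq (h1.trans hu) (hm.mono ((iterate_F_strictMono m).monotone (le_of_lt hu))).inRange

theorem IsRayPiece.eq {T₁ T₂ : ℝ} {γ₁ γ₂ : ℝ → ℂ} (hs : ExpBounded s)
    (h₁ : IsRayPiece κ s T₁ γ₁) (h₂ : IsRayPiece κ s T₂ γ₂) (ht₁ : T₁ < t) (ht₂ : T₂ < t) :
    γ₁ t = γ₂ t := by
  have hc₁ := h₁.continuousOn.mono (Set.Ioi_subset_Ioi (le_max_left T₁ T₂))
  have hc₂ := h₂.continuousOn.mono (Set.Ioi_subset_Ioi (le_max_right T₁ T₂))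
  set T := max T₁ T₂
  have hT₁ : T₁ ≤ T := le_max_left _ _
  have hT₂ : T₂ ≤ T := le_max_right _ _
  set t₀ := max T (tStar s + 2 * Real.log (‖κ‖ + 3)) + 1
  have hr : InRange κ s t₀ := ⟨hs, (le_max_right _ _).trans_lt (lt_add_one _)⟩
  have hT₀ : T < t₀ := (le_max_left _ _).trans_lt (lt_add_one _)
  refine eqOn_Ioi_of_locally_eq hc₁ hc₂ hT₀ ?_ (fun u hu heq => ?_) (max_lt ht₁ ht₂)
  · exact (h₁.iterate_E_eq (m := 0) (hT₁.trans_lt hT₀) hr).trans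
      (h₂.iterate_E_eq (m := 0) (hT₂.trans_lt hT₀) hr).symm
  · obtain ⟨t₁, m, hl, hlt, hm⟩ := exists_tail_lt κ hs (h₁.le_left.trans hT₁) hu
    refine eventuallyEq_of_iterate_E_comp (κ := κ) (m := m)
      (hc₁.continuousAt (Ioi_mem_nhds hu)) (hc₂.continuousAt (Ioi_mem_nhds hu)) heq ?_
    filter_upwards [Ioi_mem_nhds hlt] with v hv
    have hv' := (hm.mono ((iterate_F_strictMono m).monotone (le_of_lt hv))).inRange
    have hTv : T < v := hl.trans hv
    rw [h₁.iterate_E_eq (hT₁.trans_lt hTv) hv', h₂.iterate_E_eq (hT₂.trans_lt hTv) hv']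

theorem IsRayPiece.isRayPoint {T : ℝ} {γ : ℝ → ℂ} (h : IsRayPiece κ s T γ) (ht : T < t) :
    IsRayPoint κ s t (γ t) :=
  ⟨T, γ, ht, h, rfl⟩

theorem IsRayPoint.eq {z w : ℂ} (hs : ExpBounded s) (hz : IsRayPoint κ s t z)
    (hw : IsRayPoint κ s t w) : z = w := by
  obtain ⟨T₁, γ₁, ht₁, h₁, rfl⟩ := hz
  obtain ⟨T₂, γ₂, ht₂, h₂, rfl⟩ := hw
  exact h₁.eq hs h₂ ht₁ ht₂

theorem IsRayPiece.dynamicRay_eq {T : ℝ} {γ : ℝ → ℂ} (h : IsRayPiece κ s T γ)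
    (hs : ExpBounded s) (ht : T < t) : dynamicRay κ s t = γ t :=
  IsRayPoint.eq hs (Classical.epsilon_spec (⟨_, h.isRayPoint ht⟩ : ∃ z, IsRayPoint κ s t z))
    (h.isRayPoint ht)

theorem IsRayPiece.dynamicRay_eventuallyEq {T : ℝ} {γ : ℝ → ℂ} (h : IsRayPiece κ s T γ)
    (hs : ExpBounded s) (ht : T < t) : dynamicRay κ s =ᶠ[𝓝 t] γ := by
  filter_upwards [Ioi_mem_nhds ht] with u hu
  exact h.dynamicRay_eq hs hu

theorem Tail.isRayPiece (h : Tail κ s t) (hmin : minPotential s ≤ t) :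
    IsRayPiece κ s t (rayLimit κ s) where
  le_left := hmin
  continuousOn := h.contDiffOn_rayLimit.continuousOn
  orbit u hu m hm := by
    rw [(h.mono (le_of_lt hu)).inRange.iterate_E_rayLimit]
    exact ((h.mono (le_of_lt hu)).inRange.iterate_shift m).tendsto_rayApprox

theorem IsRayPiece.exists_pullback {T T' : ℝ} {γ' : ℝ → ℂ} (hs : ExpBounded s)
    (h : IsRayPiece κ (shift s) T' γ') (hT : minPotential s ≤ T) (hTT' : ∀ u, T < u → T' < F u)
    (h0 : ∀ u, T < u → γ' (F u) ≠ 0) : ∃ γ, IsRayPiece κ s T γ := by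
  have hc : ContinuousOn (fun u => γ' (F u)) (Set.Ioi T) :=
    h.continuousOn.comp continuous_F.continuousOn hTT'
  obtain ⟨g, hg, hge⟩ := exists_continuousOn_exp_eq hc h0
  set R := max T (tStar s + 2 * Real.log (‖κ‖ + 3))
  have hTR : T ≤ R := le_max_left _ _
  have hR : ∀ u, R < u → InRange κ s u := fun u hu => ⟨hs, (le_max_right _ _).trans_lt hu⟩
  have hlim : ∀ u, R < u → γ' (F u) = rayLimit κ (shift s) (F u) := fun u hu =>
    h.iterate_E_eq (m := 0) (hTT' u (hTR.trans_lt hu)) (hR u hu).shift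
  have hslit : ∀ u, R < u → γ' (F u) ∈ Complex.slitPlane := fun u hu =>
    Or.inl (by rw [hlim u hu]; exact (hR u hu).re_rayLimit_pos)
  have hEL : ∀ u, R < u → E κ (L κ (s 0) (γ' (F u))) = γ' (F u) := fun u hu =>
    E_L κ _ (h0 u (hTR.trans_lt hu))
  -- A lift is determined only up to `2πik`; this `k` selects the branch prescribed by the first
  -- entry of the address at one point, and local uniqueness extends the agreement to all of `(R,
  -- ∞)`.
  obtain ⟨k, hk⟩ := Complex.exp_eq_exp_iff_exists_int.1
    ((hge (R + 1) (by linarith)).trans (hEL (R + 1) (by linarith)).symm)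
  let γ : ℝ → ℂ := fun u => g u - k * (2 * Real.pi * Complex.I) - κ
  have hγc : ContinuousOn γ (Set.Ioi T) := (hg.sub continuousOn_const).sub continuousOn_const
  have hγE : ∀ u, T < u → E κ (γ u) = γ' (F u) := fun u hu => by
    rw [E, show γ u + κ = g u - k * (2 * Real.pi * Complex.I) by simp only [γ]; ring,
      Complex.exp_sub, Complex.exp_int_mul_two_pi_mul_I, div_one, hge u hu]
  have hLc : ContinuousOn (fun u => L κ (s 0) (γ' (F u))) (Set.Ioi R) :=
    (((hc.mono (Set.Ioi_subset_Ioi hTR)).clog hslit).sub continuousOn_const).add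
      continuousOn_const
  have hγL : Set.EqOn γ (fun u => L κ (s 0) (γ' (F u))) (Set.Ioi R) := by
    have hγc' := hγc.mono (Set.Ioi_subset_Ioi hTR)
    refine eqOn_Ioi_of_locally_eq hγc' hLc (lt_add_one R) ?_ fun u hu heq => ?_
    · simp only [γ, hk]; ring
    · refine eventuallyEq_of_E_comp (κ := κ) (hγc'.continuousAt (Ioi_mem_nhds hu))
        (hLc.continuousAt (Ioi_mem_nhds hu)) heq ?_
      filter_upwards [Ioi_mem_nhds hu] with v hv
      rw [hγE v (hTR.trans_lt hv), hEL v hv]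
  refine ⟨γ, hT, hγc, fun u hu m hm => ?_⟩
  cases m with
  | zero =>
    have hRu : R < u := max_lt hu hm
    have e : γ u = rayLimit κ s u := by
      rw [hγL hRu, (hR u hRu).rayLimit_eq, ← hlim u hRu]
    simpa only [Function.iterate_zero, id, e] using (hR u hRu).tendsto_rayApprox
  | succ m =>
    rw [Function.iterate_succ_apply (E κ), hγE u hu]
    exact h.orbit (F u) (hTT' u hu) m hm

theorem exists_isRayPiece {t₁ : ℝ} (m : ℕ) (hs : ExpBounded s) (hmin : minPotential s < t₁)
    (ht : t₁ < t) (hm : Tail κ (shift^[m] s) (F^[m] t₁))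
    (h0 : ∀ n : ℕ, 1 ≤ n → ∀ t' : ℝ, F^[n] t ≤ t' → ¬ IsRayPoint κ (shift^[n] s) t' 0) :
    ∃ T γ, T < t ∧ IsRayPiece κ s T γ := by
  induction m generalizing s t t₁ with
  | zero => exact ⟨t₁, _, ht, hm.isRayPiece hmin.le⟩
  | succ m ih =>
    obtain ⟨T', γ', hT', h'⟩ := ih hs.shift (minPotential_shift_lt hs hmin) (F_strictMono ht) hm
      fun n _ t' ht' => h0 (n + 1) (by omega) t' ht'
    have hne : ∀ u, F t ≤ u → γ' u ≠ 0 := fun u hu hu0 =>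
      h0 1 le_rfl u hu (by simpa [hu0] using h'.isRayPoint (hT'.trans_le hu))
    have hcont : ContinuousAt (fun u => γ' (F u)) t :=
      ContinuousAt.comp (g := γ') (h'.continuousOn.continuousAt (Ioi_mem_nhds hT'))
        continuous_F.continuousAt
    have hev : ∀ᶠ u in 𝓝 t, γ' (F u) ≠ 0 ∧ T' < F u :=
      (hcont.eventually_ne (hne _ le_rfl)).and
        (continuous_F.continuousAt.eventually_const_lt hT')
    -- Nonvanishing is given only from `F t` onwards; openness extends it slightly to the left, so
    -- that the new piece has `t` in its interior.
    obtain ⟨l, hl, hlt⟩ := exists_Ioc_subset_of_mem_nhds hev ⟨t₁, ht⟩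
    have hboth : ∀ u, max l t₁ < u → γ' (F u) ≠ 0 ∧ T' < F u := fun u hu => by
      rcases le_or_gt u t with hut | hut
      · exact hlt ⟨(le_max_left _ _).trans_lt hu, hut⟩
      · exact ⟨hne _ (F_strictMono hut).le, hT'.trans (F_strictMono hut)⟩
    obtain ⟨γ, hγ⟩ := h'.exists_pullback hs (hmin.le.trans (le_max_right l t₁))
      (fun u hu => (hboth u hu).2) (fun u hu => (hboth u hu).1)
    exact ⟨_, γ, max_lt hl ht, hγ⟩

theorem exists_isRayPiece_of_mem_rayDomain (hs : ExpBounded s) (ht : t ∈ rayDomain κ s) :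
    ∃ T γ, T < t ∧ IsRayPiece κ s T γ := by
  obtain ⟨t₁, m, h1, h2, hm⟩ := exists_tail_lt κ hs le_rfl ht.1
  exact exists_isRayPiece m hs h1 h2 hm ht.2

/-- Any forbidden potential `t'` is the image of an in-range potential `Finv t'`, where the limit at
the image has positive real part and so cannot be 0. -/
theorem InRange.mem_rayDomain (h : InRange κ s t) : t ∈ rayDomain κ s := by
  refine ⟨h.minPotential_lt, fun n hn t' ht' hp => ?_⟩
  obtain ⟨n, rfl⟩ : ∃ k, n = k + 1 := ⟨n - 1, by omega⟩
  obtain ⟨T, γ, hT, hγ, hγ0⟩ := hp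
  rw [Function.iterate_succ_apply'] at ht' hγ
  have hr := h.iterate_shift n
  have ht0 : 0 ≤ F^[n] t :=
    iterate_F_nonneg n ((minPotential_nonneg s).trans h.minPotential_lt.le)
  have e : F (Finv t') = t' := F_Finv (by linarith [F_nonneg ht0])
  have hr' : InRange κ (ExpRays.shift^[n] s) (Finv t') :=
    hr.mono (F_strictMono.le_iff_le.1 (by rwa [e]))
  have hre := hr'.re_rayLimit_pos
  have hs' := hr'.shift
  rw [e] at hre hs'
  have : γ t' = rayLimit κ (ExpRays.shift (ExpRays.shift^[n] s)) t' :=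
    hγ.iterate_E_eq (m := 0) hT hs'
  rw [← this, hγ0] at hre
  simp at hre

theorem Tail.dynamicRay_deriv_bounds {t₀ : ℝ} (h : Tail κ s t₀) (ht : t₀ < t) :
    ‖iteratedDeriv 2 (dynamicRay κ s) t‖ < Real.exp (-t / 2) ∧ deriv (dynamicRay κ s) t ≠ 0 ∧
      ‖iteratedDeriv 2 (dynamicRay κ s) t / deriv (dynamicRay κ s) t‖ < Real.exp (-t / 2) := by
  have hp := h.isRayPiece h.inRange.minPotential_lt.le
  have hderiv : ∀ u, t₀ < u → deriv (dynamicRay κ s) u = rayLimitSpeed κ s u := fun u hu =>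
    ((h.hasDerivAt_rayLimit hu).congr_of_eventuallyEq
      (hp.dynamicRay_eventuallyEq h.expBounded hu)).deriv
  have hev : deriv (dynamicRay κ s) =ᶠ[𝓝 t] rayLimitSpeed κ s := by
    filter_upwards [Ioi_mem_nhds ht] with u hu
    exact hderiv u hu
  have h2 : iteratedDeriv 2 (dynamicRay κ s) t = rayLimitAccel κ s t := by
    rw [iteratedDeriv_succ, iteratedDeriv_one]
    exact ((h.hasDerivAt_rayLimitSpeed ht).congr_of_eventuallyEq hev).deriv
  have htail := h.mono ht.le
  have hv := htail.norm_rayLimitSpeed_sub_one_le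
  have hv' : 15 / 16 ≤ ‖rayLimitSpeed κ s t‖ := by
    have := norm_sub_norm_le (1 : ℂ) (1 - rayLimitSpeed κ s t)
    rw [sub_sub_cancel, norm_one, norm_sub_rev] at this
    linarith
  have ha := htail.norm_rayLimitAccel_le
  have hpos := Real.exp_pos (-t / 2)
  rw [h2, hderiv t ht]
  -- The quotient is at most `(17 / 32) / (15 / 16) = 17 / 30` times `exp (-t / 2)`.
  refine ⟨by linarith, norm_pos_iff.1 (by linarith), ?_⟩
  rw [norm_div, div_lt_iff₀ (by linarith)]
  nlinarith

end ExpRays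

end

theorem proposition4p6 :
    (∀ (κ : ℂ) (s : ExpRays.Address), ExpRays.ExpBounded s →
      ∀ t ∈ ExpRays.rayDomain κ s,
        ExpRays.IsRayPoint κ s t (ExpRays.dynamicRay κ s t) ∧
          ContDiffAt ℝ 2 (ExpRays.dynamicRay κ s) t) ∧
    ExpRays.OnRayTails (fun κ s t =>
      t ∈ ExpRays.rayDomain κ s ∧
        ‖iteratedDeriv 2 (ExpRays.dynamicRay κ s) t‖ < Real.exp (-t / 2) ∧
        deriv (ExpRays.dynamicRay κ s) t ≠ 0 ∧
        ‖iteratedDeriv 2 (ExpRays.dynamicRay κ s) t / deriv (ExpRays.dynamicRay κ s) t‖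
          < Real.exp (-t / 2)) := by
  -- From `log (‖κ‖ + 3) ≤ log K + 3`, the tail condition at `t - 1` needs the constant `4 * 3 + 100
  -- + 1 = 113`. The shift by 1 leaves room to differentiate at `t`.
  refine ⟨fun κ s hs t ht => ?_, 4, 4, 120, by norm_num, by norm_num, by norm_num,
    fun s hs K hK κ hκ t ht => ?_⟩
  · obtain ⟨T, γ, hT, hγ⟩ := ExpRays.exists_isRayPiece_of_mem_rayDomain hs ht
    refine ⟨?_, (hγ.contDiffAt hs hT).congr_of_eventuallyEq (hγ.dynamicRay_eventuallyEq hs hT)⟩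
    rw [hγ.dynamicRay_eq hs hT]
    exact hγ.isRayPoint hT
  · have hlog : Real.log (‖κ‖ + 3) ≤ Real.log K + 3 := by
      rw [Real.log_le_iff_le_exp (by positivity), Real.exp_add, Real.exp_log (by linarith)]
      have := Real.add_one_le_exp (3 : ℝ)
      nlinarith
    have htail : ExpRays.Tail κ s (t - 1) := ⟨hs, by linarith⟩
    exact ⟨(htail.mono (by linarith)).inRange.mem_rayDomain,
      htail.dynamicRay_deriv_bounds (by linarith)⟩
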